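/- An equipped group $(G,O)$ is a group $G$ with a subset $O\subset G$ invariant under inner automorphisms. Its factorization semigroup $S(G,O)$ is the semigroup generated by letters $x_g$, $g\in O$, subject to the relations $x_{g_1}\cdot x_{g_2}=x_{g_2}\cdot x_{g_2^{-1}g_1g_2}=x_{g_1g_2g_1^{-1}}\cdot x_{g_1}$ for $g_1,g_2\in O$, and the product homomorphism $\alpha_G\colon S(G,O)\to G$ is given by $\alpha_G(x_g)=g$. An equipped group $(G,Y)$ is called a $C$-group, with set of $C$-generators $Y$, if the elements of $Y$ generate $G$ and, for some subset $M\subset Y^3$, the relations $y_i^{-1}y_jy_i=y_k$, $(y_i,y_j,y_k)\in M$, are defining relations of $G$ on the generators $Y$. Elements $s_1,s_2$ of a semigroup $S$ are called equivalent if $s_3\cdot s_1\cdot s_4=s_3\cdot s_2\cdot s_4$ for some $s_3,s_4\in S$. **Theorem.** Let $G$ be a $C$-group and $Y$ the set of its $C$-generators. Two elements $s_1,s_2\in S(G,Y)$ are equivalent if and only if $\alpha_G(s_1)=\alpha_G(s_2)$. -/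

import Mathlib

/-- `(G, O)` is an equipped group: the subset `O` of `G` is invariant under inner automorphisms. -/
def IsEquippedGroup (G : Type*) [Group G] (O : Set G) : Prop :=
  ∀ g a : G, a ∈ O → g * a * g⁻¹ ∈ O

/-- The relators `(y_i⁻¹ y_j y_i) y_k⁻¹`, for `(y_i, y_j, y_k) ∈ M`, in the free group on the
letters `y ∈ Y`. -/
def cRelators {G : Type*} {Y : Set G} (M : Set (Y × Y × Y)) : Set (FreeGroup Y) :=
  {r | ∃ i j k : Y, (i, j, k) ∈ M ∧
    r = ((FreeGroup.of i)⁻¹ * FreeGroup.of j * FreeGroup.of i) * (FreeGroup.of k)⁻¹}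

/-- `G` is a C-group with set of C-generators `Y`: `(G, Y)` is an equipped group, `Y` generates `G`,
and for some `M ⊆ Y³` the relations `y_i⁻¹ y_j y_i = y_k`, `(y_i, y_j, y_k) ∈ M`, are defining
relations of `G`, i.e. the kernel of the natural map from the free group on `Y` to `G` is the
normal closure of the corresponding relators. -/
structure IsCGroup (G : Type*) [Group G] (Y : Set G) : Prop where
  equipped : IsEquippedGroup G Y
  generates : Subgroup.closure Y = ⊤
  presented : ∃ M : Set (Y × Y × Y),
    (FreeGroup.lift (fun y : Y => (y : G))).ker = Subgroup.normalClosure (cRelators M)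

/-- The defining relations
`x_a · x_b = x_b · x_{b⁻¹ab}` and `x_a · x_b = x_{aba⁻¹} · x_a` (`a, b ∈ O`)
of the factorization semigroup. -/
inductive FactorizationRel {G : Type*} [Group G] (O : Set G) :
    FreeSemigroup O → FreeSemigroup O → Prop
  | right (a b c : O) (h : (c : G) = (b : G)⁻¹ * a * b) :
      FactorizationRel O (FreeSemigroup.of a * FreeSemigroup.of b)
        (FreeSemigroup.of b * FreeSemigroup.of c)
  | left (a b c : O) (h : (c : G) = (a : G) * b * (a : G)⁻¹) :
      FactorizationRel O (FreeSemigroup.of a * FreeSemigroup.of b)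
        (FreeSemigroup.of c * FreeSemigroup.of a)

/-- The factorization semigroup `S(G, O)`: the semigroup (with no identity adjoined) generated by
letters `x_g`, `g ∈ O`, subject to the relations `FactorizationRel O`. -/
abbrev FactorizationSemigroup (G : Type*) [Group G] (O : Set G) : Type _ :=
  (conGen (FactorizationRel O)).Quotient

/-- The generator `x_g` of `S(G, O)`, for `g ∈ O`. -/
def FactorizationSemigroup.x {G : Type*} [Group G] {O : Set G} (g : O) :
    FactorizationSemigroup G O :=
  ((FreeSemigroup.of g : FreeSemigroup O) : (conGen (FactorizationRel O)).Quotient)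

/-- The product of the letters of a word respects the defining relations of `S(G, O)`. -/
theorem conGen_factorizationRel_le_ker {G : Type*} [Group G] (O : Set G) :
    conGen (FactorizationRel O) ≤ Con.ker (FreeSemigroup.lift (fun g : O => (g : G))) := by
  refine Con.conGen_le.2 ?_
  rintro _ _ (⟨a, b, c, h⟩ | ⟨a, b, c, h⟩) <;>
    simp [Con.ker_rel, h, mul_assoc]

/-- The product homomorphism `α_G : S(G, O) → G`, with `α_G (x_g) = g`. -/
def productHom (G : Type*) [Group G] (O : Set G) : FactorizationSemigroup G O →ₙ* G where
  toFun s := Con.liftOn s (FreeSemigroup.lift (fun g : O => (g : G)))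
    (fun _ _ h => conGen_factorizationRel_le_ker O h)
  map_mul' s t := Con.induction_on₂ s t fun a b =>
    map_mul (FreeSemigroup.lift (fun g : O => (g : G))) a b

theorem productHom_x (G : Type*) [Group G] (O : Set G) (g : O) :
    productHom G O (FactorizationSemigroup.x g) = g := rfl

/-- Elements `s₁`, `s₂` of a semigroup `S` are equivalent if `s₃ · s₁ · s₄ = s₃ · s₂ · s₄` for some
`s₃, s₄ ∈ S`. -/
def SemigroupEquivalent {S : Type*} [Semigroup S] (s₁ s₂ : S) : Prop :=
  ∃ s₃ s₄ : S, s₃ * s₁ * s₄ = s₃ * s₂ * s₄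

namespace FactorizationSemigroup

variable {G : Type*} [Group G] {O : Set G}

/-! In `S(G, Y)` any `t` can be moved past any `s` at the cost of conjugating the letters of `s` by
the product of `t` (`mul_eq_conj_mul`). This is an Ore condition with every element as denominator,
so a group of fractions exists, and equality there amounts to equality after multiplying by a common
factor. For a C-group, the images of the letters in any group satisfy the defining relations of `G`,
so every homomorphism from `S(G, Y)` to a group factors through the product. Apply this to the map
into the group of fractions. -/

@[elab_as_elim]
theorem induction_x {p : FactorizationSemigroup G O → Prop} (s : FactorizationSemigroup G O)
    (hx : ∀ a : O, p (x a)) (hmul : ∀ (a : O) s, p s → p (x a * s)) : p s := by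
  refine Con.induction_on s fun w => ?_
  induction w with
  | ih1 a => exact hx a
  | ih2 a w _ ih => exact hmul a _ ih

theorem x_mul_x_right (a b c : O) (h : (c : G) = (b : G)⁻¹ * a * b) : x a * x b = x b * x c :=
  (Con.eq _).2 (ConGen.Rel.of _ _ (.right a b c h))

theorem x_mul_x_left (a b c : O) (h : (c : G) = (a : G) * b * (a : G)⁻¹) :
    x a * x b = x c * x a :=
  (Con.eq _).2 (ConGen.Rel.of _ _ (.left a b c h))

/-- The action of `g` on the words in the letters `x_a` by `x_a ↦ x_{g a g⁻¹}`. -/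
def conjWord (hO : IsEquippedGroup G O) (g : G) :
    FreeSemigroup O →ₙ* FactorizationSemigroup G O :=
  FreeSemigroup.lift fun a : O => x ⟨g * a * g⁻¹, hO g a a.2⟩

theorem conGen_le_ker_conjWord (hO : IsEquippedGroup G O) (g : G) :
    conGen (FactorizationRel O) ≤ Con.ker (conjWord hO g) := by
  refine Con.conGen_le.2 ?_
  rintro _ _ (⟨a, b, c, h⟩ | ⟨a, b, c, h⟩) <;>
    simp only [Con.ker_rel, conjWord, map_mul, FreeSemigroup.lift_of]
  · exact x_mul_x_right _ _ _ (by simp [h, mul_assoc])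
  · exact x_mul_x_left _ _ _ (by simp [h, mul_assoc])

/-- The simultaneous conjugation `x_a ↦ x_{g a g⁻¹}` of the letters of the factorization
semigroup. -/
def conj (hO : IsEquippedGroup G O) (g : G) :
    FactorizationSemigroup G O →ₙ* FactorizationSemigroup G O where
  toFun s := Con.liftOn s (conjWord hO g) fun _ _ h => conGen_le_ker_conjWord hO g h
  map_mul' s t := Con.induction_on₂ s t fun a b => map_mul (conjWord hO g) a b

theorem conj_x (hO : IsEquippedGroup G O) (g : G) (a : O) :
    conj hO g (x a) = x ⟨g * a * g⁻¹, hO g a a.2⟩ := rfl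

theorem conj_conj (hO : IsEquippedGroup G O) (g h : G) (s : FactorizationSemigroup G O) :
    conj hO g (conj hO h s) = conj hO (g * h) s := by
  induction s using induction_x with
  | hx a => simp [conj_x, mul_assoc]
  | hmul a s ih => simp only [map_mul, ih, conj_x, mul_assoc, mul_inv_rev]

theorem conj_one (hO : IsEquippedGroup G O) (s : FactorizationSemigroup G O) :
    conj hO 1 s = s := by
  induction s using induction_x with
  | hx a => simp [conj_x]
  | hmul a s ih => simp [map_mul, ih, conj_x]

theorem x_mul_eq (hO : IsEquippedGroup G O) (a : O) (s : FactorizationSemigroup G O) :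
    x a * s = conj hO a s * x a := by
  induction s using induction_x with
  | hx b => exact x_mul_x_left _ _ _ rfl
  | hmul b s ih =>
    rw [map_mul, mul_assoc, ← ih, ← mul_assoc, ← mul_assoc, conj_x,
      ← x_mul_x_left a b ⟨a * b * (a : G)⁻¹, hO a b b.2⟩ rfl]

/-- Carry the letters of `t` across `s` one at a time; the successive conjugations compose to
conjugation by the product of `t`. -/
theorem mul_eq_conj_mul (hO : IsEquippedGroup G O) (t s : FactorizationSemigroup G O) :
    t * s = conj hO (productHom G O t) s * t := by
  induction t using induction_x with
  | hx a => exact x_mul_eq hO a s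
  | hmul a t ih =>
    rw [map_mul, productHom_x, ← conj_conj, mul_assoc, ih, ← mul_assoc, x_mul_eq hO, mul_assoc]

/-- Simultaneous conjugation on the factorization semigroup with an identity adjoined. -/
def conjOne (hO : IsEquippedGroup G O) (g : G) :
    WithOne (FactorizationSemigroup G O) →* WithOne (FactorizationSemigroup G O) :=
  WithOne.mapMulHom (conj hO g)

theorem conjOne_coe (hO : IsEquippedGroup G O) (g : G) (s : FactorizationSemigroup G O) :
    conjOne hO g s = (conj hO g s : FactorizationSemigroup G O) := rfl

theorem conjOne_conjOne_inv (hO : IsEquippedGroup G O) (g : G)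
    (m : WithOne (FactorizationSemigroup G O)) : conjOne hO g (conjOne hO g⁻¹ m) = m := by
  induction m using WithOne.recOneCoe with
  | one => simp
  | coe s => rw [conjOne_coe, conjOne_coe, conj_conj, mul_inv_cancel, conj_one]

/-- The product homomorphism on the factorization semigroup with an identity adjoined. -/
def productHomOne (G : Type*) [Group G] (O : Set G) : WithOne (FactorizationSemigroup G O) →* G :=
  WithOne.lift (productHom G O)

theorem mul_eq_conjOne_mul (hO : IsEquippedGroup G O)
    (m n : WithOne (FactorizationSemigroup G O)) :
    m * n = conjOne hO (productHomOne G O m) n * m := by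
  induction n using WithOne.recOneCoe with
  | one => simp
  | coe s =>
    induction m using WithOne.recOneCoe with
    | one => simp [conjOne_coe, conj_one]
    | coe t =>
      rw [conjOne_coe, productHomOne, WithOne.lift_coe, ← WithOne.coe_mul, ← WithOne.coe_mul,
        mul_eq_conj_mul hO]

/-- All elements of the factorization semigroup with an identity adjoined form an Ore set. -/
@[reducible]
def oreSet (hO : IsEquippedGroup G O) :
    OreLocalization.OreSet (⊤ : Submonoid (WithOne (FactorizationSemigroup G O))) where
  ore_right_cancel r₁ r₂ s h := by
    set g := productHomOne G O s with hg
    -- Moving `s` to the left turns the hypothesis into an equality of elements conjugated by `g⁻¹`;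
    -- conjugating by `g` undoes this and turns `s` into the witness.
    refine ⟨⟨conjOne hO g s, trivial⟩, ?_⟩
    have swap (r : WithOne (FactorizationSemigroup G O)) : r * s = s * conjOne hO g⁻¹ r := by
      rw [mul_eq_conjOne_mul hO s.1, ← hg, conjOne_conjOne_inv]
    rw [swap, swap] at h
    simpa [conjOne_conjOne_inv] using congrArg (conjOne hO g) h
  oreNum r s := conjOne hO (productHomOne G O s) r
  oreDenom _ s := s
  ore_eq r s := mul_eq_conjOne_mul hO s r

/-- Two elements of the factorization semigroup with the same image in its group of fractions are
equivalent. -/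
theorem semigroupEquivalent_of_numeratorHom_eq (hO : IsEquippedGroup G O)
    {s₁ s₂ : FactorizationSemigroup G O}
    (h : letI := oreSet hO
      OreLocalization.numeratorHom (S := (⊤ : Submonoid (WithOne (FactorizationSemigroup G O))))
        (s₁ : WithOne (FactorizationSemigroup G O)) = OreLocalization.numeratorHom
        (s₂ : WithOne (FactorizationSemigroup G O))) :
    SemigroupEquivalent s₁ s₂ := by
  let := oreSet hO
  rw [OreLocalization.numeratorHom_apply, OreLocalization.numeratorHom_apply,
    OreLocalization.oreDiv_eq_iff] at h
  obtain ⟨⟨u, hmem⟩, v, huv, hu⟩ := h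
  simp only [OneMemClass.coe_one, mul_one] at hu
  subst hu
  replace huv : u * (s₂ : WithOne (FactorizationSemigroup G O)) = u * s₁ := huv
  -- The factor `u` may be the adjoined identity; multiplying by `s₁` brings it into the semigroup.
  -- The right factor is arbitrary.
  obtain ⟨t, ht⟩ : ∃ t : FactorizationSemigroup G O, (s₁ : WithOne (FactorizationSemigroup G O)) * u = t := by
    induction u using WithOne.recOneCoe with
    | one => exact ⟨s₁, mul_one _⟩
    | coe u => exact ⟨s₁ * u, rfl⟩
  refine ⟨t, s₁, WithOne.coe_inj.1 ?_⟩
  rw [WithOne.coe_mul, WithOne.coe_mul, WithOne.coe_mul, WithOne.coe_mul, ← ht, mul_assoc _ u,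
    mul_assoc _ u, huv]

end FactorizationSemigroup

open FactorizationSemigroup in
/-- For a C-group, a homomorphism from the factorization semigroup to a group takes the same value
on elements with the same product. -/
theorem IsCGroup.map_eq_of_productHom_eq {G : Type*} [Group G] {Y : Set G} (hY : IsCGroup G Y)
    {H : Type*} [Group H] (φ : FactorizationSemigroup G Y →ₙ* H)
    {s₁ s₂ : FactorizationSemigroup G Y} (h : productHom G Y s₁ = productHom G Y s₂) :
    φ s₁ = φ s₂ := by
  obtain ⟨M, hM⟩ := hY.presented
  let π : FreeGroup Y →* G := FreeGroup.lift fun y : Y => (y : G)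
  let ψ : FreeGroup Y →* H := FreeGroup.lift fun y : Y => φ (x y)
  have hker : π.ker ≤ ψ.ker := by
    have hle : cRelators M ⊆ π.ker := by
      rw [hM]; exact Subgroup.subset_normalClosure
    rw [hM]
    refine Subgroup.normalClosure_le_normal ?_
    intro r hr
    have hπ := hle hr
    obtain ⟨i, j, k, -, rfl⟩ := hr
    simp only [SetLike.mem_coe, MonoidHom.mem_ker, map_mul, map_inv, π, FreeGroup.lift_apply_of,
      mul_inv_eq_one] at hπ
    -- The relator says `i⁻¹ j i = k` in `G`, which makes `x_j x_i = x_i x_k` a defining relation of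
    -- the semigroup.
    have hφ := congrArg φ (x_mul_x_right j i k hπ.symm)
    simp only [map_mul] at hφ
    simp only [SetLike.mem_coe, MonoidHom.mem_ker, map_mul, map_inv, ψ, FreeGroup.lift_apply_of,
      mul_inv_eq_one]
    rw [mul_assoc, hφ, inv_mul_cancel_left]
  have hword (s : FactorizationSemigroup G Y) :
      ∃ w : FreeGroup Y, π w = productHom G Y s ∧ ψ w = φ s := by
    induction s using induction_x with
    | hx a => exact ⟨FreeGroup.of a, by simp [π, productHom_x], by simp [ψ]⟩
    | hmul a s ih =>
      obtain ⟨w, hw₁, hw₂⟩ := ih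
      exact ⟨FreeGroup.of a * w, by simp [hw₁, π, productHom_x], by simp [hw₂, ψ]⟩
  obtain ⟨w₁, hπ₁, hψ₁⟩ := hword s₁
  obtain ⟨w₂, hπ₂, hψ₂⟩ := hword s₂
  rw [← hψ₁, ← hψ₂]
  have : w₁ * w₂⁻¹ ∈ π.ker := by
    rw [MonoidHom.mem_ker, map_mul, map_inv, hπ₁, hπ₂, h, mul_inv_cancel]
  simpa [MonoidHom.mem_ker, mul_inv_eq_one] using hker this

theorem mainTheorem4 {G : Type*} [Group G] (Y : Set G) (hY : IsCGroup G Y)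
    (s₁ s₂ : FactorizationSemigroup G Y) :
    SemigroupEquivalent s₁ s₂ ↔ productHom G Y s₁ = productHom G Y s₂ := by
  constructor
  · rintro ⟨s₃, s₄, h⟩
    simpa using congrArg (productHom G Y) h
  · intro h
    let := FactorizationSemigroup.oreSet hY.equipped
    let S := (⊤ : Submonoid (WithOne (FactorizationSemigroup G Y)))
    -- Every element is an allowed denominator, so the image lies in the units, which form a group.
    let φ : FactorizationSemigroup G Y →ₙ* (OreLocalization S
        (WithOne (FactorizationSemigroup G Y)))ˣ :=
      { toFun s := OreLocalization.numeratorUnit (S := S) ⟨s, trivial⟩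
        map_mul' s t := Units.ext (map_mul (OreLocalization.numeratorHom (S := S))
          (s : WithOne (FactorizationSemigroup G Y)) t) }
    exact FactorizationSemigroup.semigroupEquivalent_of_numeratorHom_eq hY.equipped
      (congrArg Units.val (hY.map_eq_of_productHom_eq φ h))
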